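/- Let $\tau$ be a countable relational signature, with arities $a(R)\in\mathbb{N}$ for $R\in\tau$, and let $X_\tau=\prod_{R\in\tau}2^{\mathbb{N}^{a(R)}}$, with the product topology, be the logic space of $\tau$-structures with universe $\mathbb{N}$. Let $S_\infty$ be the group of all permutations of $\mathbb{N}$ with the topology inherited from $\mathbb{N}^{\mathbb{N}}$ ($\mathbb{N}$ discrete), acting on $X_\tau$ by letting $R$ hold of $(n_1,\dots,n_{a(R)})$ in $g(x)$ if and only if $R$ holds of $(g^{-1}(n_1),\dots,g^{-1}(n_{a(R)}))$ in $x$. Let $G$ be a closed subgroup of $S_\infty$, and let $\mathcal{F}$ be the family of all orbits $\mathrm{Orb}_G(a)=\{g(a):g\in G\}\subseteq\mathbb{N}^k$ of finite tuples $a\in\mathbb{N}^k$, $k\in\mathbb{N}$. Let $\mathscr{L}_{\omega_1\omega}(\mathcal{F})$ be the infinitary logic $\mathscr{L}_{\omega_1\omega}$ (with equality) in the signature $\tau$ augmented by a symbol for each relation in $\mathcal{F}$, with fixed interpretation as this relation. Then for every Borel set $A\subseteq X_\tau$ that is $G$-invariant (that is, $g(x)\in A$ for all $x\in A$ and $g\in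 G$), there is a sentence $\varphi$ of $\mathscr{L}_{\omega_1\omega}(\mathcal{F})$ (without parameters) such that $A=\{x\in X_\tau : x\models\varphi\}$. -/

import Mathlib

open scoped Topology

universe u v

namespace LopezEscobar

/-- Formulas of the infinitary logic `L_{ω₁ω}` (with equality) over a first-order language `L`,
whose free variables are among `x₀, …, x_{n-1}`. Conjunctions and disjunctions are countable, and
quantifiers bind the last variable `x_n` of a formula in the variables `x₀, …, x_n`. -/
inductive InfFormula (L : FirstOrder.Language.{u, v}) : ℕ → Type (max u v)
  | equal {n : ℕ} (s t : L.Term (Fin n)) : InfFormula L n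
  | rel {n k : ℕ} (R : L.Relations k) (ts : Fin k → L.Term (Fin n)) : InfFormula L n
  | neg {n : ℕ} (φ : InfFormula L n) : InfFormula L n
  | conj {n : ℕ} (φ : ℕ → InfFormula L n) : InfFormula L n
  | disj {n : ℕ} (φ : ℕ → InfFormula L n) : InfFormula L n
  | all {n : ℕ} (φ : InfFormula L (n + 1)) : InfFormula L n
  | ex {n : ℕ} (φ : InfFormula L (n + 1)) : InfFormula L n

/-- Sentences of `L_{ω₁ω}`: formulas without free variables. -/
abbrev InfSentence (L : FirstOrder.Language.{u, v}) : Type (max u v) := InfFormula L 0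

/-- Truth of an `L_{ω₁ω}`-formula in a structure under an assignment of its free variables. -/
def InfFormula.Realize {L : FirstOrder.Language.{u, v}} {M : Type*} [L.Structure M] :
    {n : ℕ} → InfFormula L n → (Fin n → M) → Prop
  | _, .equal s t, a => s.realize a = t.realize a
  | _, .rel R ts, a => FirstOrder.Language.Structure.RelMap R fun i => (ts i).realize a
  | _, .neg φ, a => ¬ φ.Realize a
  | _, .conj φ, a => ∀ i, (φ i).Realize a
  | _, .disj φ, a => ∃ i, (φ i).Realize a
  | _, .all φ, a => ∀ m : M, φ.Realize (Fin.snoc a m : Fin (_ + 1) → M)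
  | _, .ex φ, a => ∃ m : M, φ.Realize (Fin.snoc a m : Fin (_ + 1) → M)

/-- The logic space `X_τ = ∏_{R ∈ τ} 2^(ℕ^a(R))` of a relational signature `τ`. It carries the
product topology, `Bool` being discrete. -/
abbrev LogicSpace (τ : FirstOrder.Language.{u, v}) : Type v :=
  (R : Σ k, τ.Relations k) → (Fin R.1 → ℕ) → Bool

/-- The `τ`-structure with universe `ℕ` coded by a point of the logic space. -/
abbrev LogicSpace.toStructure {τ : FirstOrder.Language.{u, v}} [τ.IsRelational]
    (x : LogicSpace τ) : τ.Structure ℕ where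
  funMap f := isEmptyElim f
  RelMap {k} R a := x ⟨k, R⟩ a = true

/-- The image `g(x)` of `x ∈ X_τ` under `g ∈ S_∞`: the relation `R` holds of `a` in `g(x)` if and
only if it holds of `g⁻¹(a)` in `x`. -/
def LogicSpace.image {τ : FirstOrder.Language.{u, v}} (g : Equiv.Perm ℕ) (x : LogicSpace τ) :
    LogicSpace τ :=
  fun R a => x R fun i => g⁻¹ (a i)

/-- A set of points of the logic space is `G`-invariant if it contains `g(x)` whenever it contains
`x` and `g ∈ G`. -/
def IsInvariant {τ : FirstOrder.Language.{u, v}} (G : Subgroup (Equiv.Perm ℕ))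
    (A : Set (LogicSpace τ)) : Prop :=
  ∀ g ∈ G, ∀ x ∈ A, LogicSpace.image g x ∈ A

/-- The topology of `S_∞`, as a subspace of `ℕ^ℕ` (`ℕ` being discrete). -/
abbrev symTopology : TopologicalSpace (Equiv.Perm ℕ) :=
  TopologicalSpace.induced (fun g : Equiv.Perm ℕ => (g : ℕ → ℕ)) inferInstance

/-- A family of finitary relations on `ℕ`: for each `k`, a set of subsets of `ℕ^k`. -/
abbrev RelationFamily : Type := (k : ℕ) → Set (Set (Fin k → ℕ))

/-- The relational language with one `k`-ary symbol for each `k`-ary relation in `F`. -/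
def RelationFamily.language (F : RelationFamily) : FirstOrder.Language.{0, 0} where
  Functions _ := Empty
  Relations k := F k

/-- Each symbol for a relation in `F` is interpreted as that relation. -/
instance RelationFamily.structureNat (F : RelationFamily) : F.language.Structure ℕ where
  funMap f := Empty.elim f
  RelMap R a := a ∈ R.1

/-- The sentence `φ` of `L_{ω₁ω}(F)` holds in `x ∈ X_τ`, where the symbols of `τ` are interpreted as
in `x` and the symbols for the relations in `F` have their fixed interpretation. -/
def Satisfies {τ : FirstOrder.Language.{u, v}} [τ.IsRelational] (F : RelationFamily)
    (x : LogicSpace τ) (φ : InfSentence (τ.sum F.language)) : Prop :=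
  letI : τ.Structure ℕ := x.toStructure
  φ.Realize (Fin.elim0 : Fin 0 → ℕ)

/-- A set of points of the logic space is definable in `L_{ω₁ω}(F)` if it is the set of models of
some sentence (without parameters). -/
def IsDefinable {τ : FirstOrder.Language.{u, v}} [τ.IsRelational] (F : RelationFamily)
    (A : Set (LogicSpace τ)) : Prop :=
  ∃ φ : InfSentence (τ.sum F.language), A = {x | Satisfies F x φ}

/-- The family of all orbits `{g(a) : g ∈ G}` of finite tuples `a`, where `G` acts on `ℕ^k`
coordinatewise. -/
def orbitFamily (G : Subgroup (Equiv.Perm ℕ)) : RelationFamily :=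
  fun k => Set.range fun a : Fin k → ℕ => MulAction.orbit G a

end LopezEscobar

/-! The proof computes a Vaught transform of `A` by forcing. Topologize `G` as a subspace of `S_∞`;
since `G` is closed, it is a Polish space, and the sets of all `h ∈ G` with prescribed values
`h 0, …, h (k - 1)` form a basis. For `x` in the logic space, whether `h⁻¹(x) ∈ A` can be decided,
for generic `h`, by some finite initial segment of `h`, and this can be expressed in `x`: there are
formulas `φ k` in `k` variables such that, for every `x` and for comeagerly many `h ∈ G`,
`h⁻¹(x) ∈ A` if and only if `φ k` holds of `(h 0, …, h (k - 1))` in `x` for some `k`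
(`ForcedBy`, `forcible_of_borel`).

The sets `A` admitting such formulas form a σ-algebra. Countable unions are disjunctions. For the
complement, the formulas `φ` single out an open set `U` of `h ∈ G`, and `U` together with the
interior of its complement is a dense open set, so that the interior of `Uᶜ` serves for `Aᶜ`. The
initial segment `(b_0, …, b_{k-1})` of `h` forces `h` into this interior if no tuple extending it
that starts an element of `G` satisfies any `φ (k + m)`. A tuple starts an element of `G` if and
only if it belongs to the orbit of `(0, …, j - 1)`, which is a relation of the family
(`InfFormula.noExtension`). Finally, the atomic conditions `x R a` are forced by quantifier-free
formulas.

If `A` is `G`-invariant, then `h⁻¹(x) ∈ A` does not depend on `h`, so by the Baire category theorem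
`x ∈ A` if and only if the open set `U` attached to `x` is nonempty. This is said by a sentence. -/

namespace LopezEscobar

/-! ### The Polish topology of a closed permutation group -/

section Topology

attribute [local instance] symTopology

/-- The initial segment `(h 0, …, h (k - 1))` of a permutation. -/
def initialSegment (h : Equiv.Perm ℕ) (k : ℕ) : Fin k → ℕ := fun i => h i

lemma initialSegment_eq_iff {g h : Equiv.Perm ℕ} {k : ℕ} :
    initialSegment g k = initialSegment h k ↔ ∀ i < k, g i = h i := by
  simp [funext_iff, initialSegment, Fin.forall_iff]

lemma initialSegment_succ (h : Equiv.Perm ℕ) (k : ℕ) :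
    (Fin.snoc (initialSegment h k) (h k) : Fin (k + 1) → ℕ) = initialSegment h (k + 1) := by
  funext i
  refine Fin.lastCases ?_ (fun j => ?_) i <;> simp [initialSegment]

lemma initialSegment_succ_eq_snoc_iff {h : Equiv.Perm ℕ} {k : ℕ} {a : Fin k → ℕ} {m : ℕ} :
    initialSegment h (k + 1) = Fin.snoc a m ↔ initialSegment h k = a ∧ h k = m := by
  rw [← initialSegment_succ, Fin.snoc_inj]

lemma isOpen_setOf_apply_eq (n m : ℕ) : IsOpen {g : Equiv.Perm ℕ | g n = m} := by
  have : Continuous fun g : Equiv.Perm ℕ => g n :=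
    (continuous_apply (A := fun _ => ℕ) n).comp continuous_induced_dom
  exact (isOpen_discrete {m}).preimage this

lemma continuous_inv_apply : Continuous fun g : Equiv.Perm ℕ => ((g⁻¹ : Equiv.Perm ℕ) : ℕ → ℕ) := by
  refine continuous_pi fun n => continuous_discrete_rng.2 fun m => ?_
  convert isOpen_setOf_apply_eq m n using 1
  ext g
  exact Equiv.Perm.inv_eq_iff_eq.trans eq_comm

lemma isClosed_setOf_comp_eq_id : IsClosed {p : (ℕ → ℕ) × (ℕ → ℕ) | ∀ n, p.1 (p.2 n) = n} := by
  have : {p : (ℕ → ℕ) × (ℕ → ℕ) | ∀ n, p.1 (p.2 n) = n} =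
      ⋂ n, ⋂ m, ({p | p.2 n = m}ᶜ ∪ {p | p.1 m = n}) := by
    ext p
    simp [← imp_iff_not_or]
  rw [this]
  refine isClosed_iInter fun n => isClosed_iInter fun m => ?_
  refine IsClosed.union (IsOpen.isClosed_compl ?_) ?_
  · exact (isOpen_discrete {m}).preimage ((continuous_apply (A := fun _ => ℕ) n).comp continuous_snd)
  · exact (isClosed_discrete {n}).preimage ((continuous_apply (A := fun _ => ℕ) m).comp continuous_fst)

/-- A closed subgroup of `S_∞` is even a Polish space: `g ↦ (g, g⁻¹)` embeds it as a closed subspace of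
`ℕ^ℕ × ℕ^ℕ`. -/
lemma baireSpace_of_isClosed {G : Subgroup (Equiv.Perm ℕ)}
    (hG : IsClosed (G : Set (Equiv.Perm ℕ))) : BaireSpace G := by
  obtain ⟨C, hC, hCG⟩ := isClosed_induced_iff.1 hG
  let e : G → (ℕ → ℕ) × (ℕ → ℕ) := fun g => (g.1, (g.1⁻¹ : Equiv.Perm ℕ))
  have he : Continuous e :=
    (continuous_induced_dom.comp continuous_subtype_val).prodMk
      (continuous_inv_apply.comp continuous_subtype_val)
  have hfst : Topology.IsInducing fun g : G => (e g).1 :=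
    (Topology.IsInducing.induced fun g : Equiv.Perm ℕ => (g : ℕ → ℕ)).comp
      Topology.IsInducing.subtypeVal
  have hinj : Function.Injective e := fun g h hgh =>
    Subtype.ext (DFunLike.coe_injective (congrArg Prod.fst hgh))
  have hrange : Set.range e = Prod.fst ⁻¹' C ∩ {p : (ℕ → ℕ) × (ℕ → ℕ) | ∀ n, p.1 (p.2 n) = n} ∩
      Prod.swap ⁻¹' {p : (ℕ → ℕ) × (ℕ → ℕ) | ∀ n, p.1 (p.2 n) = n} := by
    ext ⟨p, q⟩
    constructor
    · rintro ⟨g, hg⟩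
      obtain ⟨rfl, rfl⟩ := Prod.mk.inj hg
      have : g.1 ∈ (fun g : Equiv.Perm ℕ => (g : ℕ → ℕ)) ⁻¹' C := hCG ▸ g.2
      exact ⟨⟨this, fun n => by simp⟩, fun n => by simp⟩
    · rintro ⟨⟨hp, hpq⟩, hqp⟩
      let g : Equiv.Perm ℕ := ⟨p, q, hqp, hpq⟩
      have hg : g ∈ (G : Set (Equiv.Perm ℕ)) := hCG ▸ hp
      exact ⟨⟨g, hg⟩, rfl⟩
  have hcl : Topology.IsClosedEmbedding e := by
    refine ⟨⟨Topology.IsInducing.of_comp he continuous_fst hfst, hinj⟩, ?_⟩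
    rw [hrange]
    exact ((hC.preimage continuous_fst).inter isClosed_setOf_comp_eq_id).inter
      (isClosed_setOf_comp_eq_id.preimage continuous_swap)
  have := hcl.polishSpace
  infer_instance

variable {G : Subgroup (Equiv.Perm ℕ)}

lemma isOpen_setOf_initialSegment_eq {k : ℕ} (a : Fin k → ℕ) :
    IsOpen {h : G | initialSegment h k = a} := by
  have : {h : G | initialSegment h k = a} =
      ⋂ i : Fin k, Subtype.val ⁻¹' {g : Equiv.Perm ℕ | g i = a i} := by
    ext h
    simp [funext_iff, initialSegment]
  rw [this]
  exact isOpen_iInter_of_finite fun i => (isOpen_setOf_apply_eq _ _).preimage continuous_subtype_val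

lemma exists_initialSegment_subset {U : Set G} (hU : IsOpen U) {g : G} (hg : g ∈ U) :
    ∃ k, ∀ h : G, initialSegment h k = initialSegment g k → h ∈ U := by
  obtain ⟨V, hV, rfl⟩ := isOpen_induced_iff.1 hU
  obtain ⟨W, hW, rfl⟩ := isOpen_induced_iff.1 hV
  obtain ⟨I, u, hu, hIu⟩ := isOpen_pi_iff.1 hW _ hg
  refine ⟨I.sup id + 1, fun h hh => hIu fun i hi => ?_⟩
  have hi' : i < I.sup id + 1 := Nat.lt_succ_of_le (Finset.le_sup (f := id) hi)
  change h.1 i ∈ u i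
  rw [initialSegment_eq_iff.1 hh i hi']
  exact (hu i hi).2

end Topology

/-! ### Formulas about extensions of a tuple within the group -/

variable {τ : FirstOrder.Language.{u, v}} [τ.IsRelational] {G : Subgroup (Equiv.Perm ℕ)}

/-- Truth of a formula of `L_{ω₁ω}(F)` at a tuple in the structure coded by `x`. -/
def LogicSpace.Holds {F : RelationFamily} (x : LogicSpace τ) {n : ℕ}
    (φ : InfFormula (τ.sum F.language) n) (a : Fin n → ℕ) : Prop :=
  letI : τ.Structure ℕ := x.toStructure
  φ.Realize a

/-- The atomic formula saying that `(x_0, …, x_{n-1})` is the initial segment of an element of `G`: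
it belongs to the orbit of `(0, …, n - 1)`. -/
def InfFormula.isInitialSegment (τ : FirstOrder.Language.{u, v}) (G : Subgroup (Equiv.Perm ℕ)) (n : ℕ) :
    InfFormula (τ.sum (orbitFamily G).language) n :=
  .rel (k := n) (Sum.inr ⟨MulAction.orbit G (fun i : Fin n => (i : ℕ)), Set.mem_range_self _⟩)
    fun i => .var i

lemma holds_isInitialSegment {x : LogicSpace τ} {n : ℕ} {a : Fin n → ℕ} :
    x.Holds (InfFormula.isInitialSegment τ G n) a ↔ ∃ h : G, initialSegment h n = a :=
  Iff.rfl

/-- The formula saying of `(x_0, …, x_{k-1})` that no tuple extending it by `m` entries is the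
initial segment of an element of `G` and satisfies `φ (k + m)`. -/
def InfFormula.noExtension (φ : ∀ k, InfFormula (τ.sum (orbitFamily G).language) k) :
    ℕ → ∀ k, InfFormula (τ.sum (orbitFamily G).language) k
  | 0, k => .disj fun i => if i = 0 then .neg (isInitialSegment τ G k) else .neg (φ k)
  | m + 1, k => .all (noExtension φ m (k + 1))

lemma holds_noExtension {φ : ∀ k, InfFormula (τ.sum (orbitFamily G).language) k}
    {x : LogicSpace τ} (m : ℕ) {k : ℕ} {a : Fin k → ℕ} :
    x.Holds (InfFormula.noExtension φ m k) a ↔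
      ∀ h : G, initialSegment h k = a → ¬ x.Holds (φ (k + m)) (initialSegment h (k + m)) := by
  induction m generalizing k with
  | zero =>
    have : x.Holds (InfFormula.noExtension φ 0 k) a ↔
        ¬ x.Holds (InfFormula.isInitialSegment τ G k) a ∨ ¬ x.Holds (φ k) a := by
      constructor
      · rintro ⟨_ | i, hi⟩
        exacts [.inl hi, .inr hi]
      · rintro (h | h)
        exacts [⟨0, h⟩, ⟨1, h⟩]
    rw [this, holds_isInitialSegment]
    constructor
    · rintro h g rfl
      exact h.resolve_left (not_not_intro ⟨g, rfl⟩)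
    · intro h
      by_cases ha : ∃ g : G, initialSegment g k = a
      · obtain ⟨g, rfl⟩ := ha
        exact .inr (h g rfl)
      · exact .inl ha
  | succ m ih =>
    have : x.Holds (InfFormula.noExtension φ (m + 1) k) a ↔
        ∀ v, x.Holds (InfFormula.noExtension φ m (k + 1)) (Fin.snoc a v) := Iff.rfl
    have hadd (h : G) : x.Holds (φ (k + 1 + m)) (initialSegment h (k + 1 + m)) ↔
        x.Holds (φ (k + (m + 1))) (initialSegment h (k + (m + 1))) := by
      rw [Nat.add_right_comm]
      rfl
    simp only [this, ih, initialSegment_succ_eq_snoc_iff, and_imp, hadd]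
    exact ⟨fun h g hg => h _ g hg rfl, fun h v g hg _ => h g hg⟩

/-! ### Forcing membership in a Borel set -/

attribute [local instance] symTopology

/-- The set of those `h ∈ G` some initial segment of which satisfies its formula of `φ` in `x`. -/
def forcedSet (φ : ∀ k, InfFormula (τ.sum (orbitFamily G).language) k) (x : LogicSpace τ) : Set G :=
  {h | ∃ k, x.Holds (φ k) (initialSegment h k)}

/-- The formulas `φ` force membership in `A`: their truth passes on to longer initial segments of
elements of `G`, and for comeagerly many `h ∈ G`, the point `h⁻¹(x)` is in `A` if and only if some
initial segment of `h` satisfies its formula in `x`. -/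
structure ForcedBy (A : Set (LogicSpace τ))
    (φ : ∀ k, InfFormula (τ.sum (orbitFamily G).language) k) : Prop where
  mono : ∀ (x : LogicSpace τ) (h : G) (k : ℕ),
    x.Holds (φ k) (initialSegment h k) → x.Holds (φ (k + 1)) (initialSegment h (k + 1))
  generic : ∀ x : LogicSpace τ,
    ∀ᶠ h : G in residual G, LogicSpace.image (h.1⁻¹) x ∈ A ↔ h ∈ forcedSet φ x

lemma ForcedBy.mono_le {A : Set (LogicSpace τ)}
    {φ : ∀ k, InfFormula (τ.sum (orbitFamily G).language) k} (hφ : ForcedBy A φ)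
    {x : LogicSpace τ} {h : G} {k l : ℕ} (hkl : k ≤ l) (hk : x.Holds (φ k) (initialSegment h k)) :
    x.Holds (φ l) (initialSegment h l) :=
  Nat.le_induction hk (fun n _ => hφ.mono x h n) l hkl

lemma isOpen_forcedSet (φ : ∀ k, InfFormula (τ.sum (orbitFamily G).language) k)
    (x : LogicSpace τ) : IsOpen (forcedSet φ x) := by
  have : forcedSet φ x = ⋃ k, ⋃ a ∈ {a | x.Holds (φ k) a}, {h : G | initialSegment h k = a} := by
    ext h
    simp [forcedSet]
  rw [this]
  exact isOpen_iUnion fun k => isOpen_biUnion fun a _ => isOpen_setOf_initialSegment_eq a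

lemma ForcedBy.holds_conj_noExtension {A : Set (LogicSpace τ)}
    {φ : ∀ k, InfFormula (τ.sum (orbitFamily G).language) k} (hφ : ForcedBy A φ)
    {x : LogicSpace τ} {k : ℕ} {a : Fin k → ℕ} :
    x.Holds (.conj fun m => InfFormula.noExtension φ m k) a ↔
      ∀ h : G, initialSegment h k = a → h ∉ forcedSet φ x := by
  have : x.Holds (.conj fun m => InfFormula.noExtension φ m k) a ↔
      ∀ m, x.Holds (InfFormula.noExtension φ m k) a := Iff.rfl
  simp only [this, holds_noExtension]
  constructor
  · rintro h g hg ⟨l, hl⟩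
    -- Monotonicity provides a witness of length at least `k`.
    exact h l g hg (hφ.mono_le (Nat.le_add_left l k) hl)
  · exact fun h m g hg hm => h g hg ⟨_, hm⟩

lemma ForcedBy.forcedSet_conj_noExtension {A : Set (LogicSpace τ)}
    {φ : ∀ k, InfFormula (τ.sum (orbitFamily G).language) k} (hφ : ForcedBy A φ)
    (x : LogicSpace τ) :
    forcedSet (fun k => .conj fun m => InfFormula.noExtension φ m k) x =
      (closure (forcedSet φ x))ᶜ := by
  ext g
  simp only [forcedSet, Set.mem_ofPred_eq, hφ.holds_conj_noExtension]
  rw [← interior_compl]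
  constructor
  · rintro ⟨k, hk⟩
    exact mem_interior.2 ⟨_, hk, isOpen_setOf_initialSegment_eq _, rfl⟩
  · intro hg
    obtain ⟨k, hk⟩ := exists_initialSegment_subset isOpen_interior hg
    exact ⟨k, fun h hh => interior_subset (hk h hh)⟩

lemma ForcedBy.compl {A : Set (LogicSpace τ)}
    {φ : ∀ k, InfFormula (τ.sum (orbitFamily G).language) k} (hφ : ForcedBy A φ) :
    ForcedBy Aᶜ fun k => .conj fun m => InfFormula.noExtension φ m k where
  mono x h k hk := by
    rw [hφ.holds_conj_noExtension] at hk ⊢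
    exact fun g hg => hk g (initialSegment_eq_iff.2 fun i hi =>
      initialSegment_eq_iff.1 hg i (Nat.lt_succ_of_lt hi))
  generic x := by
    rw [hφ.forcedSet_conj_noExtension]
    have hdense : Dense (forcedSet φ x ∪ (closure (forcedSet φ x))ᶜ) := by
      rw [dense_iff_closure_eq, closure_union, Set.eq_univ_iff_forall]
      exact fun g => (em (g ∈ closure (forcedSet φ x))).imp_right (subset_closure ·)
    have hres := residual_of_dense_open
      ((isOpen_forcedSet φ x).union isClosed_closure.isOpen_compl) hdense
    filter_upwards [hφ.generic x, hres] with h hA hh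
    rw [Set.mem_compl_iff, hA, Set.mem_compl_iff]
    exact ⟨fun hU => hh.resolve_left hU, fun hU hU' => hU (subset_closure hU')⟩

lemma ForcedBy.iUnion {A : ℕ → Set (LogicSpace τ)}
    {φ : ℕ → ∀ k, InfFormula (τ.sum (orbitFamily G).language) k}
    (hφ : ∀ i, ForcedBy (A i) (φ i)) :
    ForcedBy (⋃ i, A i) fun k => .disj fun i => φ i k where
  mono x h k := fun ⟨i, hi⟩ => ⟨i, (hφ i).mono x h k hi⟩
  generic x := by
    filter_upwards [eventually_countable_forall.2 fun i => (hφ i).generic x] with h hA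
    simp only [Set.mem_iUnion, hA]
    exact exists_comm

lemma forcedBy_empty :
    ForcedBy (∅ : Set (LogicSpace τ)) fun k => .neg (InfFormula.isInitialSegment τ G k) where
  mono _ h _ hk := (hk ⟨h, rfl⟩).elim
  generic _ := .of_forall fun h => ⟨False.elim, fun ⟨_, hk⟩ => hk ⟨h, rfl⟩⟩

lemma exists_forcedBy_setOf_apply_eq_true (R : Σ k, τ.Relations k) (n : Fin R.1 → ℕ) :
    ∃ φ : ∀ k, InfFormula (τ.sum (orbitFamily G).language) k,
      ForcedBy {x : LogicSpace τ | x R n = true} φ := by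
  classical
  -- For `h` in `G`, `R` holds of `n` in `h⁻¹(x)` iff it holds of `h(n)` in `x`, and the tuple
  -- `h(n)` is read off from an initial segment of `h` longer than the entries of `n`.
  let φ : ∀ k, InfFormula (τ.sum (orbitFamily G).language) k := fun k =>
    if hn : ∀ i, n i < k then .rel (k := R.1) (Sum.inl R.2) fun i => .var ⟨n i, hn i⟩
    else .neg (.isInitialSegment τ G k)
  have key (x : LogicSpace τ) (h : G) (k : ℕ) : x.Holds (φ k) (initialSegment h k) ↔
      (∀ i, n i < k) ∧ x R (fun i => h.1 (n i)) = true := by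
    by_cases hn : ∀ i, n i < k
    · simp only [φ, dif_pos hn, hn, implies_true, true_and]
      rfl
    · simp only [φ, dif_neg hn, hn, false_and, iff_false]
      exact fun hk => hk ⟨h, rfl⟩
  refine ⟨φ, fun x h k => ?_, fun x => .of_forall fun h => ?_⟩
  · rw [key, key]
    exact fun ⟨hn, hx⟩ => ⟨fun i => Nat.lt_succ_of_lt (hn i), hx⟩
  · simp only [forcedSet, key, Set.mem_ofPred_eq, LogicSpace.image, inv_inv, exists_and_right]
    exact ⟨fun hx => ⟨⟨Finset.univ.sup n + 1, fun i =>
      Nat.lt_succ_of_le (Finset.le_sup (Finset.mem_univ i))⟩, hx⟩, And.right⟩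

variable (G) in
/-- Over a countable signature, the Borel sets are generated by the sets `{x | x R n}`, since the
logic space is then a countable product. -/
lemma forcible_of_borel [Countable (Σ k, τ.Relations k)] {A : Set (LogicSpace τ)}
    (hA : @MeasurableSet (LogicSpace τ) (borel (LogicSpace τ)) A) :
    ∃ φ : ∀ k, InfFormula (τ.sum (orbitFamily G).language) k, ForcedBy A φ := by
  let m : MeasurableSpace (LogicSpace τ) :=
    { MeasurableSet' A := ∃ φ : ∀ k, InfFormula (τ.sum (orbitFamily G).language) k, ForcedBy A φ
      measurableSet_empty := ⟨_, forcedBy_empty⟩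
      measurableSet_compl _ := fun ⟨_, hφ⟩ => ⟨_, hφ.compl⟩
      measurableSet_iUnion A hA := by
        choose φ hφ using hA
        exact ⟨_, ForcedBy.iUnion hφ⟩ }
  have hid : @Measurable _ _ m MeasurableSpace.pi (id : LogicSpace τ → LogicSpace τ) :=
    measurable_pi_iff.2 fun R => measurable_pi_iff.2 fun n =>
      measurable_to_bool (exists_forcedBy_setOf_apply_eq_true R n)
  have hborel : (MeasurableSpace.pi : MeasurableSpace (LogicSpace τ)) = borel _ :=
    BorelSpace.measurable_eq
  rw [← hborel] at hA
  exact hid hA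

/-- For an invariant set, generic membership is plain membership, so a point belongs to it if and
only if its forced set, which is open, is nonempty. -/
lemma ForcedBy.isDefinable [BaireSpace G] {A : Set (LogicSpace τ)} (hinv : IsInvariant G A)
    {φ : ∀ k, InfFormula (τ.sum (orbitFamily G).language) k} (hφ : ForcedBy A φ) :
    IsDefinable (orbitFamily G) A := by
  refine ⟨.neg (.conj fun m => InfFormula.noExtension φ m 0), Set.ext fun x => ?_⟩
  have hsat : Satisfies (orbitFamily G) x (.neg (.conj fun m => InfFormula.noExtension φ m 0)) ↔
      (forcedSet φ x).Nonempty := by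
    refine (not_congr hφ.holds_conj_noExtension).trans ?_
    simp [Subsingleton.elim _ (Fin.elim0 : Fin 0 → ℕ), Set.Nonempty]
  have hgen := dense_of_mem_residual (hφ.generic x)
  rw [Set.mem_ofPred_eq, hsat]
  constructor
  · intro hx
    obtain ⟨h, hh⟩ := hgen.nonempty
    exact ⟨h, hh.1 (hinv _ (inv_mem h.2) x hx)⟩
  · intro hU
    obtain ⟨h, hhU, hh⟩ := hgen.inter_open_nonempty _ (isOpen_forcedSet φ x) hU
    have himage : LogicSpace.image h.1 (LogicSpace.image h.1⁻¹ x) = x := by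
      funext R a
      simp [LogicSpace.image]
    exact himage ▸ hinv _ h.2 _ (hh.2 hhU)

end LopezEscobar

theorem proposition3 (τ : FirstOrder.Language.{u, v}) [τ.IsRelational] [Countable (Σ k, τ.Relations k)]
    (G : Subgroup (Equiv.Perm ℕ))
    (hG : IsClosed[LopezEscobar.symTopology] (G : Set (Equiv.Perm ℕ)))
    (A : Set (LopezEscobar.LogicSpace τ))
    (hA : @MeasurableSet (LopezEscobar.LogicSpace τ) (borel (LopezEscobar.LogicSpace τ)) A)
    (hinv : LopezEscobar.IsInvariant G A) :
    LopezEscobar.IsDefinable (LopezEscobar.orbitFamily G) A := by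
  have := LopezEscobar.baireSpace_of_isClosed hG
  obtain ⟨φ, hφ⟩ := LopezEscobar.forcible_of_borel G hA
  exact hφ.isDefinable hinv
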